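/- Let $\Omega\subset\mathbb{R}^N$ be a bounded domain, let $\mathcal{O}\subset\mathbb{R}^N$ be open with $\overline\Omega\subset\mathcal{O}$, let $\mathcal{S}_N$ be the space of real symmetric $N\times N$ matrices with its usual partial order, and let $F:\mathcal{O}\times\mathbb{R}\times\mathbb{R}^N\times\mathcal{S}_N\to\mathbb{R}$ be continuous. We write $F[u](x)=F(x,u(x),Du(x),D^2u(x))$. Assume: (H1) $F(x,r,p,X+Y)-F(x,r,p,X)\le 0$ for all $x\in\mathcal{O}$, $r\in\mathbb{R}$, $p\in\mathbb{R}^N$, $X,Y\in\mathcal{S}_N$ with $Y\ge 0$. (H2) There is $\alpha>0$ such that $F(x,\tau r,\tau p,\tau X)=\tau^\alpha F(x,r,p,X)$ for all $(x,r,p,X)\in\mathcal{O}\times\mathbb{R}\times\mathbb{R}^N\times\mathcal{S}_N$ and $\tau\ge 0$. (H3) $r\mapsto F(x,r,p,X)$ is continuous, uniformly with respect to $(x,p,X)\in\mathcal{O}\times\mathbb{R}^N\times\mathcal{S}_N$. (H4) For every $R>0$ there is $\omega\in C([0,+\infty))$ with $\omega(0)=0$ such that, whenever $X,Y\in\mathcal{S}_N$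 and $\sigma>0$ satisfy $$-3\sigma\begin{pmatrix} I&0\\0&I\end{pmatrix}\le\begin{pmatrix} X&0\\0&-Y\end{pmatrix}\le 3\sigma\begin{pmatrix} I&-I\\-I&I\end{pmatrix},$$ one has $F(y,r,\sigma(x-y),Y)-F(x,r,\sigma(x-y),X)\le\omega(\sigma|x-y|^2+|x-y|)$ for all $x,y\in\mathcal{O}$ and $|r|\le R$. Define $$\mu_1(F,\Omega):=\sup\{\lambda\in\mathbb{R}:\ \exists\,\Omega'\text{ open},\ \overline\Omega\subset\Omega'\subset\mathcal{O},\ \exists\,\phi\in LSC(\Omega'),\ \phi>0\text{ and }F[\phi]-\lambda\phi^\alpha\ge0\text{ in }\Omega'\}\in[-\infty,+\infty],$$ where the differential inequality is meant in the viscosity sense: $F(\xi,\phi(\xi),D\psi(\xi),D^2\psi(\xi))-\lambda\phi(\xi)^\alpha\ge0$ whenever $\psi\in C^2(\mathbb{R}^N)$ and $\phi-\psi$ has a local minimum at $\xi\in\Omega'$. For $G:\mathcal{O}\times\mathbb{R}\times\mathbb{R}^N\times\mathcal{S}_N\to[-\infty,+\infty]$, a function $u\in USC(\overline\Omega)$ is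 called a subsolution of $G[u]\le0$ in $\Omega$, $u\le0$ on $\partial\Omega$ (in the relaxed viscosity sense) if, for all $\varphi\in C^2(\mathbb{R}^N)$ and $\xi\in\overline\Omega$ such that $(u-\varphi)(\xi)=\max_{\overline\Omega}(u-\varphi)$, $$G(\xi,u(\xi),D\varphi(\xi),D^2\varphi(\xi))\le0\ \text{ if }\xi\in\Omega,\qquad \min\big[u(\xi),\,G(\xi,u(\xi),D\varphi(\xi),D^2\varphi(\xi))\big]\le0\ \text{ if }\xi\in\partial\Omega.$$ $F$ satisfies the Maximum Principle in $\Omega$ if every such subsolution $u\in USC(\overline\Omega)$ with $G=F$ satisfies $u\le0$ in $\overline\Omega$. Then there exists a nonnegative function $U\in USC(\overline\Omega)$, $U\not\equiv0$, which is a subsolution, in the relaxed viscosity sense above, of $$F[U]-\mu_1(F,\Omega)U^\alpha\le0\ \text{ in }\Omega,\qquad U\le0\ \text{ on }\partial\Omega$$ (with the convention $(+\infty)\cdot0=0$ if $\mu_1(F,\Omega)=+\infty$). Moreover, if $F$ satisfies the Maximum Principle in $\Omega$, then $\mu_1(F,\Omega)>0$. -/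

import Mathlib

noncomputable section

namespace DegEll

/-- The Euclidean space `ℝ^N`. -/
abbrev Sp (N : ℕ) : Type := EuclideanSpace ℝ (Fin N)

/-- Real `N × N` matrices; operators below are only ever evaluated at (and only ever constrained on)
symmetric ones. -/
abbrev Mat (N : ℕ) : Type := Matrix (Fin N) (Fin N) ℝ

/-- Second order operators `F(x, r, p, X)`. Only the values for `x` in the relevant set and `X`
symmetric matter. -/
abbrev Op (N : ℕ) : Type := Sp N → ℝ → Sp N → Mat N → ℝ

/-- The Hessian matrix `D²φ(x)`. -/
def hessian {N : ℕ} (φ : Sp N → ℝ) (x : Sp N) : Mat N :=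
  Matrix.of fun i j =>
    fderiv ℝ (fderiv ℝ φ) x (EuclideanSpace.single i 1) (EuclideanSpace.single j 1)

/-- `F` is continuous on `𝒪 × ℝ × ℝ^N × 𝒮_N`. -/
def ContinuousOp {N : ℕ} (F : Op N) (O : Set (Sp N)) : Prop :=
  ContinuousOn (fun q : Sp N × ℝ × Sp N × Mat N => F q.1 q.2.1 q.2.2.1 q.2.2.2)
    {q | q.1 ∈ O ∧ q.2.2.2.IsSymm}

/-- (H1) Degenerate ellipticity. -/
def H1 {N : ℕ} (F : Op N) (O : Set (Sp N)) : Prop :=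
  ∀ x ∈ O, ∀ (r : ℝ) (p : Sp N) (X Y : Mat N), X.IsSymm → Y.PosSemidef →
    F x r p (X + Y) - F x r p X ≤ 0

/-- (H2) Positive homogeneity of degree `α`. -/
def H2 {N : ℕ} (F : Op N) (O : Set (Sp N)) (α : ℝ) : Prop :=
  ∀ x ∈ O, ∀ (r : ℝ) (p : Sp N) (X : Mat N), X.IsSymm → ∀ τ : ℝ, 0 ≤ τ →
    F x (τ * r) (τ • p) (τ • X) = τ ^ α * F x r p X

/-- (H3) `r ↦ F(x,r,p,X)` is continuous, uniformly with respect to `(x,p,X)`. -/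
def H3 {N : ℕ} (F : Op N) (O : Set (Sp N)) : Prop :=
  ∀ r : ℝ, ∀ ε > 0, ∃ δ > 0, ∀ s : ℝ, |s - r| < δ →
    ∀ x ∈ O, ∀ (p : Sp N) (X : Mat N), X.IsSymm → |F x s p X - F x r p X| < ε

/-- The two-sided matrix inequality
`-3σ [I 0; 0 I] ≤ [X 0; 0 -Y] ≤ 3σ [I -I; -I I]`. -/
def BlockIneq {N : ℕ} (σ : ℝ) (X Y : Mat N) : Prop :=
  (Matrix.fromBlocks X 0 0 (-Y) - (-(3 * σ)) • Matrix.fromBlocks (1 : Mat N) 0 0 1).PosSemidef ∧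
  ((3 * σ) • Matrix.fromBlocks (1 : Mat N) (-1) (-1) 1 - Matrix.fromBlocks X 0 0 (-Y)).PosSemidef

/-- (H4) The structure condition. -/
def H4 {N : ℕ} (F : Op N) (O : Set (Sp N)) : Prop :=
  ∀ R > 0, ∃ ω : ℝ → ℝ, ContinuousOn ω (Set.Ici 0) ∧ ω 0 = 0 ∧
    ∀ X Y : Mat N, X.IsSymm → Y.IsSymm → ∀ σ > 0, BlockIneq σ X Y →
      ∀ x ∈ O, ∀ y ∈ O, ∀ r : ℝ, |r| ≤ R →
        F y r (σ • (x - y)) Y - F x r (σ • (x - y)) X ≤ ω (σ * ‖x - y‖ ^ 2 + ‖x - y‖)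

/-- `φ` is a viscosity supersolution of `F[φ] - l φ^α ≥ 0` in the open set `V`
(used for positive `φ`). -/
def IsSupersolution {N : ℕ} (F : Op N) (α l : ℝ) (V : Set (Sp N)) (φ : Sp N → ℝ) : Prop :=
  ∀ ψ : Sp N → ℝ, ContDiff ℝ 2 ψ → ∀ ξ ∈ V, IsLocalMinOn (fun x => φ x - ψ x) V ξ →
    0 ≤ F ξ (φ ξ) (gradient ψ ξ) (hessian ψ ξ) - l * φ ξ ^ α

/-- The generalized principal eigenvalue `μ₁(F, Ω)`, an element of `[-∞, +∞]`, for an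
`α`-homogeneous operator given in the open set `O`. -/
def mu1 {N : ℕ} (F : Op N) (α : ℝ) (O Ω : Set (Sp N)) : EReal :=
  sSup ((fun l : ℝ => (l : EReal)) '' {l : ℝ | ∃ V : Set (Sp N), IsOpen V ∧ closure Ω ⊆ V ∧ V ⊆ O ∧
    ∃ φ : Sp N → ℝ, LowerSemicontinuousOn φ V ∧ (∀ x ∈ V, 0 < φ x) ∧ IsSupersolution F α l V φ})

/-- `u` is a viscosity subsolution of `G(x,u,Du,D²u) ≤ 0` in `Ω`, `u ≤ 0` on `∂Ω`, the
boundary condition being understood in the relaxed viscosity sense: at a boundary point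
touched from above by a test function, `u ≤ 0` or the differential inequality holds.
`G` may take extended real values. -/
def IsDirichletSubsolution {N : ℕ} (G : Sp N → ℝ → Sp N → Mat N → EReal) (Ω : Set (Sp N))
    (u : Sp N → ℝ) : Prop :=
  ∀ φ : Sp N → ℝ, ContDiff ℝ 2 φ → ∀ ξ ∈ closure Ω, IsMaxOn (fun x => u x - φ x) (closure Ω) ξ →
    (ξ ∈ Ω → G ξ (u ξ) (gradient φ ξ) (hessian φ ξ) ≤ 0) ∧
    (ξ ∈ frontier Ω → min (u ξ : EReal) (G ξ (u ξ) (gradient φ ξ) (hessian φ ξ)) ≤ 0)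

/-- The Maximum Principle in `Ω`: every upper semicontinuous viscosity subsolution of the
Dirichlet problem `F[u] = 0` in `Ω`, `u = 0` on `∂Ω` is nonpositive in `closure Ω`. -/
def MaximumPrinciple {N : ℕ} (F : Op N) (Ω : Set (Sp N)) : Prop :=
  ∀ u : Sp N → ℝ, UpperSemicontinuousOn u (closure Ω) →
    IsDirichletSubsolution (fun x r p X => (F x r p X : EReal)) Ω u →
    ∀ x ∈ closure Ω, u x ≤ 0

/-- The operator `F[u] - m u^α` for an extended real number `m`; for `m = +∞` the convention
`(+∞) * 0 = 0` of `EReal` is in force. It is only used for `u ≥ 0`. -/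
def eigenOp {N : ℕ} (F : Op N) (α : ℝ) (m : EReal) (x : Sp N) (r : ℝ) (p : Sp N) (X : Mat N) :
    EReal :=
  (F x r p X : EReal) - m * ((r ^ α : ℝ) : EReal)

end DegEll

end

/-! Fix `lam` above the eigenvalue and a compact neighbourhood of the closed domain in `O`.
Nonnegative subsolutions of `F[u] ≤ lam u^α + 1` there cannot be uniformly bounded. If they were,
their envelope would be the largest one, and Perron's bump argument
(`one_le_of_isLocalMin_lowerEnv`) would make its lower regularization `p` satisfy `F[p] ≥ lam p^α +
1`. Since `F(x,0,0,0) = 0`, this also forces `p > 0`, so `lam` would be admissible in `mu1`.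

Now let `lam` decrease to a finite eigenvalue while the neighbourhoods shrink to the closed domain,
and divide subsolutions with ever larger maxima by those maxima. By homogeneity the source term 1
tends to 0. The half-relaxed upper limit solves the limiting inequality
(`IsPosSubsolution.of_upperLim`), and compactness keeps the maximum value 1 from being lost. The
approximating sets surround the boundary, so the limit is tested there too, which gives the relaxed
boundary condition. The eigenvalue is never `-∞`; if it is `+∞`, a constant works.

If the eigenvalue is nonpositive, this nontrivial subsolution is also one for `F`, against the
Maximum Principle. -/

noncomputable section

open Filter Topology Set

namespace DegEll

/-! ### Second derivatives at minima and at zeros of squares -/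

section SecondOrder

variable {E : Type*} [NormedAddCommGroup E] [NormedSpace ℝ E]

/-- Second order necessary condition at a local minimum. -/
theorem fderiv_fderiv_nonneg_of_isLocalMin {f : E → ℝ} (hf : ContDiff ℝ 2 f) {ξ : E}
    (h : IsLocalMin f ξ) (v : E) : 0 ≤ fderiv ℝ (fderiv ℝ f) ξ v v := by
  by_contra! hneg
  have hline : ∀ t : ℝ, HasDerivAt (fun t : ℝ => ξ + t • v) v t := fun t => by
    simpa using ((hasDerivAt_id t).smul_const v).const_add ξ
  set g : ℝ → ℝ := fun t => f (ξ + t • v) with hg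
  have hd : Differentiable ℝ f := hf.differentiable (by norm_num)
  have hd' : Differentiable ℝ (fderiv ℝ f) :=
    (hf.fderiv_right (m := 1) (by norm_num)).differentiable (by norm_num)
  have hg1 : deriv g = fun t => fderiv ℝ f (ξ + t • v) v := by
    funext t
    exact ((hd _).hasFDerivAt.comp_hasDerivAt t (hline t)).deriv
  have hg2 : deriv (deriv g) 0 = fderiv ℝ (fderiv ℝ f) ξ v v := by
    rw [hg1]
    have h1 : HasDerivAt (fun t : ℝ => fderiv ℝ f (ξ + t • v))
        (fderiv ℝ (fderiv ℝ f) (ξ + (0 : ℝ) • v) v) 0 :=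
      (hd' _).hasFDerivAt.comp_hasDerivAt 0 (hline 0)
    have h2 := (h1.clm_apply (hasDerivAt_const (0 : ℝ) v)).deriv
    simpa using h2
  have hline0 : Tendsto (fun t : ℝ => ξ + t • v) (𝓝 0) (𝓝 ξ) := by
    simpa using (hline 0).continuousAt.tendsto
  have hmin : IsLocalMin g 0 := by
    have := hline0.eventually h
    simpa [IsLocalMin, IsMinFilter, hg] using this
  -- A negative second derivative would make 0 a local maximum as well, so `g` would be locally
  -- constant and its second derivative zero.
  have hmax : IsLocalMax g 0 := by
    refine isLocalMax_of_deriv_deriv_neg (by rw [hg2]; exact hneg) hmin.deriv_eq_zero ?_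
    exact ((hd _).hasFDerivAt.comp_hasDerivAt 0 (hline 0)).continuousAt
  have hconst : g =ᶠ[𝓝 0] fun _ => g 0 := by
    filter_upwards [hmin, hmax] with t h1 h2 using le_antisymm h2 h1
  have : deriv (deriv g) 0 = 0 := by
    rw [hconst.deriv.deriv_eq]
    simp
  rw [hg2] at this
  exact hneg.ne this

theorem fderiv_sq {s : E → ℝ} (hs : Differentiable ℝ s) :
    fderiv ℝ (fun x => s x ^ 2) = fun x => (2 * s x) • fderiv ℝ s x := by
  funext x
  have := ((hs x).hasFDerivAt.pow 2).fderiv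
  simpa using this

/-- Both terms of `D²(s²) = 2 Ds ⊗ Ds + 2 s D²s` vanish. With `s = ‖x - ξ‖²`, the quartic penalty
leaves the second-order jet of a test function at `ξ` unchanged. -/
theorem fderiv_fderiv_sq_eq_zero {s : E → ℝ} (hs : ContDiff ℝ 2 s) {ξ : E} (h0 : s ξ = 0)
    (h1 : fderiv ℝ s ξ = 0) : fderiv ℝ (fderiv ℝ fun x => s x ^ 2) ξ = 0 := by
  have hd : Differentiable ℝ s := hs.differentiable (by norm_num)
  have hd' : Differentiable ℝ (fderiv ℝ s) :=
    (hs.fderiv_right (m := 1) (by norm_num)).differentiable (by norm_num)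
  rw [fderiv_sq hd]
  have := (((hd ξ).hasFDerivAt.const_mul 2).smul (hd' ξ).hasFDerivAt).fderiv
  refine this.trans ?_
  ext
  simp [h0, h1]

end SecondOrder

/-! ### Gradients, Hessians and ellipticity along test functions -/

variable {N : ℕ}

theorem differentiable_fderiv {φ : Sp N → ℝ} (hφ : ContDiff ℝ 2 φ) :
    Differentiable ℝ (fderiv ℝ φ) :=
  (hφ.fderiv_right (m := 1) (by norm_num)).differentiable (by norm_num)

theorem continuous_gradient {φ : Sp N → ℝ} (hφ : ContDiff ℝ 2 φ) : Continuous (gradient φ) :=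
  (InnerProductSpace.toDual ℝ (Sp N)).symm.continuous.comp (hφ.continuous_fderiv (by norm_num))

theorem continuous_hessian {φ : Sp N → ℝ} (hφ : ContDiff ℝ 2 φ) : Continuous (hessian φ) := by
  have h : Continuous (fderiv ℝ (fderiv ℝ φ)) :=
    (hφ.fderiv_right (m := 1) (by norm_num)).continuous_fderiv (by norm_num)
  refine continuous_matrix fun i j => ?_
  exact (h.clm_apply continuous_const).clm_apply continuous_const

theorem isSymm_hessian {φ : Sp N → ℝ} (hφ : ContDiff ℝ 2 φ) (x : Sp N) :
    (hessian φ x).IsSymm := by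
  ext i j
  have h : IsSymmSndFDerivAt ℝ φ x := hφ.contDiffAt.isSymmSndFDerivAt (by simp)
  exact h _ _

theorem gradient_add {φ ψ : Sp N → ℝ} (hφ : ContDiff ℝ 2 φ) (hψ : ContDiff ℝ 2 ψ) (x : Sp N) :
    gradient (fun y => φ y + ψ y) x = gradient φ x + gradient ψ x := by
  have h := fderiv_fun_add (hφ.differentiable (by norm_num) x) (hψ.differentiable (by norm_num) x)
  simp only [gradient, h, map_add]

theorem hessian_add {φ ψ : Sp N → ℝ} (hφ : ContDiff ℝ 2 φ) (hψ : ContDiff ℝ 2 ψ) (x : Sp N) :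
    hessian (fun y => φ y + ψ y) x = hessian φ x + hessian ψ x := by
  have h : fderiv ℝ (fun y => φ y + ψ y) = fun y => fderiv ℝ φ y + fderiv ℝ ψ y :=
    funext fun y =>
      fderiv_fun_add (hφ.differentiable (by norm_num) y) (hψ.differentiable (by norm_num) y)
  have h' := fderiv_fun_add (differentiable_fderiv hφ x) (differentiable_fderiv hψ x)
  ext i j
  simp [hessian, h, h']

theorem gradient_const_mul {φ : Sp N → ℝ} (hφ : ContDiff ℝ 2 φ) (c : ℝ) (x : Sp N) :
    gradient (fun y => c * φ y) x = c • gradient φ x := by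
  have h := fderiv_const_mul (hφ.differentiable (by norm_num) x) c
  simp only [gradient, h, map_smul]

theorem hessian_const_mul {φ : Sp N → ℝ} (hφ : ContDiff ℝ 2 φ) (c : ℝ) (x : Sp N) :
    hessian (fun y => c * φ y) x = c • hessian φ x := by
  have h : fderiv ℝ (fun y => c * φ y) = fun y => c • fderiv ℝ φ y :=
    funext fun y => fderiv_const_mul (hφ.differentiable (by norm_num) y) c
  have h' := fderiv_fun_const_smul (differentiable_fderiv hφ x) c
  ext i j
  simp [hessian, h, h']

theorem gradient_const_fun (c : ℝ) (x : Sp N) : gradient (fun _ : Sp N => c) x = 0 := by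
  simp [gradient]

theorem hessian_const_fun (c : ℝ) (x : Sp N) : hessian (fun _ : Sp N => c) x = 0 := by
  ext i j
  simp [hessian]

/-- The penalization `‖x - ξ‖ ^ 4` used to make extrema strict. -/
def quartic (ξ x : Sp N) : ℝ := (‖x - ξ‖ ^ 2) ^ 2

theorem contDiff_normSq_sub (ξ : Sp N) : ContDiff ℝ 2 fun x : Sp N => ‖x - ξ‖ ^ 2 :=
  (contDiff_id.sub contDiff_const).norm_sq ℝ

theorem contDiff_quartic (ξ : Sp N) : ContDiff ℝ 2 (quartic ξ) :=
  (contDiff_normSq_sub ξ).pow 2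

theorem quartic_self (ξ : Sp N) : quartic ξ ξ = 0 := by simp [quartic]

theorem quartic_nonneg (ξ x : Sp N) : 0 ≤ quartic ξ x := by unfold quartic; positivity

theorem quartic_pos {ξ x : Sp N} (h : x ≠ ξ) : 0 < quartic ξ x := by
  have : 0 < ‖x - ξ‖ := norm_pos_iff.2 (sub_ne_zero.2 h)
  unfold quartic; positivity

theorem fderiv_normSq_sub_self (ξ : Sp N) :
    fderiv ℝ (fun x : Sp N => ‖x - ξ‖ ^ 2) ξ = 0 := by
  refine IsLocalMin.fderiv_eq_zero (Eventually.of_forall fun x => ?_)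
  simp

theorem gradient_quartic_self (ξ : Sp N) : gradient (quartic ξ) ξ = 0 := by
  have h : fderiv ℝ (quartic ξ) ξ = 0 :=
    IsLocalMin.fderiv_eq_zero (Eventually.of_forall fun x => by
      rw [quartic_self]; exact quartic_nonneg ξ x)
  simp [gradient, h]

theorem hessian_quartic_self (ξ : Sp N) : hessian (quartic ξ) ξ = 0 := by
  have h : fderiv ℝ (fderiv ℝ (quartic ξ)) ξ = 0 :=
    fderiv_fderiv_sq_eq_zero (contDiff_normSq_sub ξ) (by simp) (fderiv_normSq_sub_self ξ)
  ext i j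
  simp [hessian, h]

theorem gradient_eq_zero_of_isLocalMin {φ : Sp N → ℝ} {ξ : Sp N} (h : IsLocalMin φ ξ) :
    gradient φ ξ = 0 := by
  simp [gradient, h.fderiv_eq_zero]

theorem dotProduct_hessian_mulVec (φ : Sp N → ℝ) (ξ : Sp N) (x : Fin N → ℝ) :
    x ⬝ᵥ (hessian φ ξ).mulVec x =
      fderiv ℝ (fderiv ℝ φ) ξ (WithLp.toLp 2 x) (WithLp.toLp 2 x) := by
  have hx : WithLp.toLp 2 x = ∑ i, x i • (EuclideanSpace.single i (1 : ℝ)) := by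
    ext j
    simp [Finset.sum_apply, Pi.single_apply]
  rw [hx]
  simp only [dotProduct, Matrix.mulVec, hessian, Matrix.of_apply, map_sum, map_smul,
    _root_.sum_apply, _root_.smul_apply, smul_eq_mul, Finset.mul_sum]
  rw [Finset.sum_comm]
  refine Finset.sum_congr rfl fun i _ => Finset.sum_congr rfl fun j _ => ?_
  ring

theorem posSemidef_hessian_of_isLocalMin {φ : Sp N → ℝ} (hφ : ContDiff ℝ 2 φ) {ξ : Sp N}
    (h : IsLocalMin φ ξ) : (hessian φ ξ).PosSemidef := by
  refine Matrix.PosSemidef.of_dotProduct_mulVec_nonneg ?_ fun x => ?_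
  · rw [Matrix.IsHermitian, Matrix.conjTranspose_eq_transpose_of_trivial]
    exact isSymm_hessian hφ ξ
  · rw [star_trivial, dotProduct_hessian_mulVec]
    exact fderiv_fderiv_nonneg_of_isLocalMin hφ h _

/-- Degenerate ellipticity along test functions: if `φ - ψ` has a local minimum at `ξ`, the value
of the operator on `φ` is at most its value on `ψ`. -/
theorem H1.le_of_isLocalMin {F : Op N} {O : Set (Sp N)} (h1 : H1 F O) {φ ψ : Sp N → ℝ}
    (hφ : ContDiff ℝ 2 φ) (hψ : ContDiff ℝ 2 ψ) {ξ : Sp N} (hξ : ξ ∈ O)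
    (h : IsLocalMin (fun x => φ x - ψ x) ξ) (r : ℝ) :
    F ξ r (gradient φ ξ) (hessian φ ξ) ≤ F ξ r (gradient ψ ξ) (hessian ψ ξ) := by
  have hd : ContDiff ℝ 2 fun x => φ x - ψ x := hφ.sub hψ
  have hg : gradient φ ξ = gradient ψ ξ := by
    have := gradient_add hψ hd ξ
    rw [gradient_eq_zero_of_isLocalMin h] at this
    simpa using this
  have hh : hessian φ ξ = hessian ψ ξ + hessian (fun x => φ x - ψ x) ξ := by
    have := hessian_add hψ hd ξ
    simpa using this
  rw [hg, hh]
  exact sub_nonpos.1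
    (h1 ξ hξ r _ _ _ (isSymm_hessian hψ ξ) (posSemidef_hessian_of_isLocalMin hd h))

theorem H2.apply_zero {F : Op N} {O : Set (Sp N)} {α : ℝ} (h2 : H2 F O α) (hα : 0 < α)
    {x : Sp N} (hx : x ∈ O) : F x 0 0 0 = 0 := by
  have := h2 x hx 0 0 0 Matrix.isSymm_zero 0 le_rfl
  simpa [Real.zero_rpow hα.ne'] using this

/-! ### Half-relaxed upper limits and convergence of maximum points -/

section UpperLim

variable {ι E : Type*}

/-- A tube lemma for filters; it takes the place of extracting convergent subsequences of points. -/
theorem eventually_forall_of_isCompact [TopologicalSpace E] {l : Filter ι} {K : Set E}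
    (hK : IsCompact K) {P : ι → E → Prop} (h : ∀ y ∈ K, ∀ᶠ p in l ×ˢ 𝓝 y, P p.1 p.2) :
    ∀ᶠ i in l, ∀ y ∈ K, P i y := by
  have h' : ∀ᶠ p in l ×ˢ 𝓝ˢ K, P p.1 p.2 := hK.mem_prod_nhdsSet_of_forall h
  exact h'.curry.mono fun _ hi => hi.self_of_nhdsSet

/-- The nonnegative half-relaxed upper limit along `l` of functions `u i` given on sets `K i`. -/
def upperLim [TopologicalSpace E] (l : Filter ι) (K : ι → Set E) (u : ι → E → ℝ) (x : E) : ℝ :=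
  sInf {a : ℝ | 0 ≤ a ∧ ∀ᶠ p in l ×ˢ 𝓝 x, p.2 ∈ K p.1 → u p.1 p.2 ≤ a}

section

variable [TopologicalSpace E] {l : Filter ι} {K : ι → Set E} {u : ι → E → ℝ}

theorem upperLim_nonneg (x : E) : 0 ≤ upperLim l K u x :=
  Real.sInf_nonneg fun _ ha => ha.1

theorem upperLim_le {x : E} {a : ℝ} (ha : 0 ≤ a)
    (h : ∀ᶠ p in l ×ˢ 𝓝 x, p.2 ∈ K p.1 → u p.1 p.2 ≤ a) : upperLim l K u x ≤ a :=
  csInf_le ⟨0, fun _ hb => hb.1⟩ ⟨ha, h⟩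

theorem upperLim_set_nonempty {M : ℝ} (hM : 0 ≤ M) (hu : ∀ i, ∀ x ∈ K i, u i x ≤ M) (x : E) :
    {a : ℝ | 0 ≤ a ∧ ∀ᶠ p in l ×ˢ 𝓝 x, p.2 ∈ K p.1 → u p.1 p.2 ≤ a}.Nonempty :=
  ⟨M, hM, Eventually.of_forall fun p hp => hu p.1 p.2 hp⟩

theorem eventually_lt_of_upperLim_lt {M : ℝ} (hM : 0 ≤ M) (hu : ∀ i, ∀ x ∈ K i, u i x ≤ M) {x : E}
    {a : ℝ} (h : upperLim l K u x < a) :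
    ∀ᶠ p in l ×ˢ 𝓝 x, p.2 ∈ K p.1 → u p.1 p.2 < a := by
  obtain ⟨b, hb, hba⟩ := exists_lt_of_csInf_lt (upperLim_set_nonempty hM hu x) h
  exact hb.2.mono fun p hp hpK => (hp hpK).trans_lt hba

/-- Where the limit is positive, the floor 0 in its definition is inactive, so its value is really
approached by the `u i`. This is why subsolutions are tested only at positive points. -/
theorem frequently_lt_of_lt_upperLim {x : E} (hpos : 0 < upperLim l K u x) {a : ℝ}
    (h : a < upperLim l K u x) : ∃ᶠ p in l ×ˢ 𝓝 x, p.2 ∈ K p.1 ∧ a < u p.1 p.2 := by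
  intro hcon
  have hle : upperLim l K u x ≤ max a 0 := by
    refine upperLim_le (le_max_right _ _) (hcon.mono fun p hp hpK => ?_)
    by_contra! hlt
    exact hp ⟨hpK, (le_max_left _ _).trans_lt hlt⟩
  exact absurd hle (not_le.2 (max_lt h hpos))

theorem upperSemicontinuous_upperLim {M : ℝ} (hM : 0 ≤ M) (hu : ∀ i, ∀ x ∈ K i, u i x ≤ M) :
    UpperSemicontinuous (upperLim l K u) := by
  intro x a hxa
  obtain ⟨b, ⟨hb0, hb⟩, hba⟩ := exists_lt_of_csInf_lt (upperLim_set_nonempty hM hu x) hxa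
  obtain ⟨s, hs, t, ht, hst⟩ := mem_prod_iff.1 hb
  filter_upwards [eventually_mem_nhds_iff.2 ht] with y hy
  refine (upperLim_le hb0 ?_).trans_lt hba
  exact mem_of_superset (prod_mem_prod hs hy) hst

end

/-- Maximum points of `u i - φ` approach a strict maximum point of `U - φ`, where `U` is the
half-relaxed upper limit of the `u i`. -/
theorem frequently_exists_isMaxOn [PseudoMetricSpace E] {l : Filter ι} {K : ι → Set E}
    {K₀ C : Set E} (hK₀ : IsCompact K₀) (hK : ∀ i, IsCompact (K i)) (hsub : ∀ i, K i ⊆ K₀)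
    (hC : ∀ x ∉ C, ∀ᶠ p in l ×ˢ 𝓝 x, p.2 ∉ K p.1) {u : ι → E → ℝ}
    (hu : ∀ i, UpperSemicontinuousOn (u i) (K i)) {U φ : E → ℝ} (hφ : Continuous φ) {ξ : E}
    (hup : ∀ x ∈ C, ∀ a, U x < a → ∀ᶠ p in l ×ˢ 𝓝 x, p.2 ∈ K p.1 → u p.1 p.2 < a)
    (hlow : ∀ a < U ξ, ∃ᶠ p in l ×ˢ 𝓝 ξ, p.2 ∈ K p.1 ∧ a < u p.1 p.2)
    (hmax : ∀ x ∈ C, x ≠ ξ → U x - φ x < U ξ - φ ξ) {ε : ℝ} (hε : 0 < ε) :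
    ∃ᶠ i in l, ∃ y ∈ K i, dist y ξ < ε ∧ |u i y - U ξ| < ε ∧
      IsMaxOn (fun x => u i x - φ x) (K i) y := by
  have hT : ∀ x : E, Tendsto (fun q : (ℝ × ι) × E => (q.1.2, q.2))
      ((𝓝[>] (0 : ℝ) ×ˢ l) ×ˢ 𝓝 x) (l ×ˢ 𝓝 x) := fun x =>
    (tendsto_snd.comp tendsto_fst).prodMk tendsto_snd
  have hφx : ∀ x : E, ∀ δ > 0, ∀ᶠ y in 𝓝 x, |φ y - φ x| < δ := fun x δ hδ => by
    simpa [Real.dist_eq] using Metric.tendsto_nhds.1 hφ.continuousAt δ hδ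
  -- The coordinate `q.1` is a slack tending to `0+`: every point where `u i - φ` nearly reaches `U
  -- ξ - φ ξ` must lie close to `ξ`. Away from `ξ` the strict gap `d` excludes it, and off `C` the
  -- sets `K i` do.
  have key : ∀ᶠ q in 𝓝[>] (0 : ℝ) ×ˢ l, ∀ y ∈ K₀, y ∈ K q.2 →
      U ξ - φ ξ - q.1 < u q.2 y - φ y →
        (dist y ξ < ε ∧ |φ y - φ ξ| < ε / 2) ∧ u q.2 y < U ξ + ε := by
    refine eventually_forall_of_isCompact hK₀ fun x _ => ?_
    by_cases hxC : x ∈ C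
    · by_cases hx : x = ξ
      · subst hx
        have h1 := (hT x).eventually (hup x hxC (U x + ε) (by linarith))
        have h2 : ∀ᶠ q in (𝓝[>] (0 : ℝ) ×ˢ l) ×ˢ 𝓝 x,
            dist q.2 x < ε ∧ |φ q.2 - φ x| < ε / 2 :=
          tendsto_snd.eventually
            ((Metric.eventually_nhds_iff.2 ⟨ε, hε, fun _ h => h⟩).and (hφx x _ (by positivity)))
        filter_upwards [h1, h2] with q h1 h2 hqK _ using ⟨h2, h1 hqK⟩
      · have hgap := hmax x hxC hx
        set d := U ξ - φ ξ - (U x - φ x) with hd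
        have hd0 : 0 < d := by linarith
        have h1 := (hT x).eventually (hup x hxC (U x + d / 3) (by linarith))
        have h2 : ∀ᶠ q in (𝓝[>] (0 : ℝ) ×ˢ l) ×ˢ 𝓝 x, |φ q.2 - φ x| < d / 3 :=
          tendsto_snd.eventually (hφx x _ (by positivity))
        have h3 : ∀ᶠ q in (𝓝[>] (0 : ℝ) ×ˢ l) ×ˢ 𝓝 x, q.1.1 < d / 3 := by
          have : ∀ᶠ η in 𝓝[>] (0 : ℝ), η < d / 3 :=
            nhdsWithin_le_nhds (Iio_mem_nhds (by positivity))
          exact (tendsto_fst.comp tendsto_fst).eventually this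
        filter_upwards [h1, h2, h3] with q h1 h2 h3 hqK hlt
        have h1 := h1 hqK
        have h2 := (abs_lt.1 h2).1
        linarith
    · filter_upwards [(hT x).eventually (hC x hxC)] with q hq hqK using absurd hqK hq
  -- The slack and the oscillation of `φ` each cost at most `ε / 2` in the lower bound for `u i y`.
  have hη : ∀ᶠ η in 𝓝[>] (0 : ℝ), 0 < η ∧ η < ε / 2 :=
    Ioo_mem_nhdsGT (by positivity)
  obtain ⟨η, hkey, hη0, hηε⟩ := (key.curry.and hη).exists
  have hfr : ∃ᶠ p in l ×ˢ 𝓝 ξ, p.2 ∈ K p.1 ∧ U ξ - φ ξ - η < u p.1 p.2 - φ p.2 := by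
    have h2 : ∀ᶠ p in l ×ˢ 𝓝 ξ, |φ p.2 - φ ξ| < η / 2 :=
      tendsto_snd.eventually (hφx ξ _ (by positivity))
    refine ((hlow (U ξ - η / 2) (by linarith)).and_eventually h2).mono ?_
    rintro p ⟨⟨hpK, hp⟩, hp2⟩
    have := (abs_lt.1 hp2).2
    exact ⟨hpK, by linarith⟩
  have hfr' : ∃ᶠ i in l, ∃ x, x ∈ K i ∧ U ξ - φ ξ - η < u i x - φ x :=
    (tendsto_fst (f := l) (g := 𝓝 ξ)).frequently (hfr.mono fun p hp => ⟨p.2, hp⟩)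
  refine (hfr'.and_eventually hkey).mono ?_
  rintro i ⟨⟨x, hxK, hx⟩, hi⟩
  have husc : UpperSemicontinuousOn (fun x => u i x - φ x) (K i) := by
    have := (hu i).add (hφ.neg.upperSemicontinuous.upperSemicontinuousOn (K i))
    simpa [sub_eq_add_neg] using this
  obtain ⟨y, hyK, hy⟩ := husc.exists_isMaxOn ⟨x, hxK⟩ (hK i)
  have hxy : u i x - φ x ≤ u i y - φ y := hy hxK
  obtain ⟨⟨h1, h2⟩, h3⟩ := hi y (hsub i hyK) hyK (hx.trans_le hxy)
  refine ⟨y, hyK, h1, abs_lt.2 ⟨?_, by linarith⟩, hy⟩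
  have := (abs_lt.1 h2).1
  linarith

end UpperLim

/-! ### Viscosity subsolutions and their stability -/

/-- `u` satisfies `F[u] ≤ lam u^α + c` in the viscosity sense at the points of `K` where it is
positive, test functions touching from above relatively to `K`. -/
def IsPosSubsolution (F : Op N) (α lam c : ℝ) (K : Set (Sp N)) (u : Sp N → ℝ) : Prop :=
  ∀ φ : Sp N → ℝ, ContDiff ℝ 2 φ → ∀ ξ ∈ K, IsMaxOn (fun x => u x - φ x) K ξ → 0 < u ξ →
    F ξ (u ξ) (gradient φ ξ) (hessian φ ξ) ≤ lam * u ξ ^ α + c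

theorem continuousOn_op_test {F : Op N} {O : Set (Sp N)} (hF : ContinuousOp F O) {φ : Sp N → ℝ}
    (hφ : ContDiff ℝ 2 φ) :
    ContinuousOn (fun q : Sp N × ℝ => F q.1 q.2 (gradient φ q.1) (hessian φ q.1))
      {q | q.1 ∈ O} := by
  have h : Continuous fun q : Sp N × ℝ => (q.1, q.2, gradient φ q.1, hessian φ q.1) :=
    continuous_fst.prodMk (continuous_snd.prodMk
      (((continuous_gradient hφ).comp continuous_fst).prodMk
        ((continuous_hessian hφ).comp continuous_fst)))
  exact hF.comp h.continuousOn fun q hq => ⟨hq, isSymm_hessian hφ _⟩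

/-- Stability of subsolutions under half-relaxed upper limits. -/
theorem IsPosSubsolution.of_upperLim {ι : Type*} {l : Filter ι} {F : Op N} {O : Set (Sp N)}
    {α : ℝ} (hα : 0 < α) (hO : IsOpen O) (hF : ContinuousOp F O) {K : ι → Set (Sp N)}
    {K₀ C : Set (Sp N)}
    (hK₀ : IsCompact K₀) (hK : ∀ i, IsCompact (K i)) (hsub : ∀ i, K i ⊆ K₀)
    (hCO : C ⊆ O) (hC : ∀ x ∉ C, ∀ᶠ p in l ×ˢ 𝓝 x, p.2 ∉ K p.1) {u : ι → Sp N → ℝ}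
    (hu : ∀ i, UpperSemicontinuousOn (u i) (K i)) {M : ℝ} (hM : 0 ≤ M)
    (huM : ∀ i, ∀ x ∈ K i, u i x ≤ M) {lam c : ι → ℝ} {lam₀ c₀ : ℝ}
    (hlam : Tendsto lam l (𝓝 lam₀)) (hc : Tendsto c l (𝓝 c₀))
    (hsol : ∀ i, IsPosSubsolution F α (lam i) (c i) (K i) (u i)) :
    IsPosSubsolution F α lam₀ c₀ C (upperLim l K u) := by
  intro φ hφ ξ hξ hmax hpos
  set U := upperLim l K u
  by_contra! hlt
  set φ' : Sp N → ℝ := fun x => φ x + quartic ξ x with hφ'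
  have hφ'2 : ContDiff ℝ 2 φ' := hφ.add (contDiff_quartic ξ)
  have hg : gradient φ' ξ = gradient φ ξ := by
    rw [hφ', gradient_add hφ (contDiff_quartic ξ), gradient_quartic_self, add_zero]
  have hh : hessian φ' ξ = hessian φ ξ := by
    rw [hφ', hessian_add hφ (contDiff_quartic ξ), hessian_quartic_self, add_zero]
  have hstrict : ∀ x ∈ C, x ≠ ξ → U x - φ' x < U ξ - φ' ξ := fun x hx hne => by
    have h1 : U x - φ x ≤ U ξ - φ ξ := hmax hx
    have h2 := quartic_pos hne
    have h3 := quartic_self ξ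
    simp only [hφ']
    linarith
  -- The negated inequality is strict, so by continuity it persists near `(ξ, U ξ)` and far along
  -- `l`.
  have hev : ∀ᶠ q in l ×ˢ 𝓝 (ξ, U ξ), lam q.1 * q.2.2 ^ α + c q.1 <
      F q.2.1 q.2.2 (gradient φ' q.2.1) (hessian φ' q.2.1) := by
    have hOn : {q : Sp N × ℝ | q.1 ∈ O} ∈ 𝓝 (ξ, U ξ) :=
      (hO.preimage continuous_fst).mem_nhds (hCO hξ)
    have h1 : Tendsto (fun q : Sp N × ℝ => F q.1 q.2 (gradient φ' q.1) (hessian φ' q.1))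
        (𝓝 (ξ, U ξ)) (𝓝 (F ξ (U ξ) (gradient φ' ξ) (hessian φ' ξ))) :=
      ((continuousOn_op_test hF hφ'2).continuousAt hOn).tendsto
    have h2 : Tendsto (fun q : ι × (Sp N × ℝ) => lam q.1 * q.2.2 ^ α + c q.1)
        (l ×ˢ 𝓝 (ξ, U ξ)) (𝓝 (lam₀ * U ξ ^ α + c₀)) := by
      have h3 : Tendsto (fun q : Sp N × ℝ => q.2 ^ α) (𝓝 (ξ, U ξ)) (𝓝 (U ξ ^ α)) :=
        (Real.continuousAt_rpow_const (U ξ) α (Or.inr hα.le)).tendsto.comp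
          continuous_snd.continuousAt
      exact ((hlam.comp tendsto_fst).mul (h3.comp tendsto_snd)).add (hc.comp tendsto_fst)
    rw [hg, hh] at h1
    exact h2.eventually_lt (h1.comp tendsto_snd) hlt
  obtain ⟨P, hP, Q, hQ, hPQ⟩ := eventually_prod_iff.1 hev
  obtain ⟨ε, hε, hball⟩ := Metric.eventually_nhds_iff.1 hQ
  -- Closeness within `U ξ` keeps `u i y` positive, so the inequality for `u i` may be tested at
  -- `y`.
  have hfr := frequently_exists_isMaxOn hK₀ hK hsub hC hu hφ'2.continuous
    (fun x _ a ha => eventually_lt_of_upperLim_lt hM huM ha)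
    (fun a ha => frequently_lt_of_lt_upperLim hpos ha) hstrict (lt_min hε hpos)
  obtain ⟨i, ⟨y, hyK, hy1, hy2, hy3⟩, hPi⟩ := (hfr.and_eventually hP).exists
  have hQy : Q (y, u i y) := hball <| by
    rw [Prod.dist_eq]
    exact max_lt (hy1.trans_le (min_le_left _ _)) (by
      rw [Real.dist_eq]; exact hy2.trans_le (min_le_left _ _))
  have hpos' : 0 < u i y := by
    have := (abs_lt.1 (hy2.trans_le (min_le_right _ _))).1
    linarith
  exact absurd (hsol i φ' hφ'2 y hyK hy3 hpos') (not_le.2 (hPQ hPi hQy))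

/-! ### Lower semicontinuous envelopes -/

section LowerEnv

variable {E : Type*} [TopologicalSpace E]

/-- The lower semicontinuous envelope (of a function bounded below). -/
def lowerEnv (v : E → ℝ) (x : E) : ℝ := sSup {a : ℝ | ∀ᶠ y in 𝓝 x, a ≤ v y}

variable {v : E → ℝ}

theorem bddAbove_lowerEnv (v : E → ℝ) (x : E) : BddAbove {a : ℝ | ∀ᶠ y in 𝓝 x, a ≤ v y} :=
  ⟨v x, fun a ha => (show ∀ᶠ y in 𝓝 x, a ≤ v y from ha).self_of_nhds⟩

theorem nonempty_lowerEnv (hv : ∀ x, 0 ≤ v x) (x : E) :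
    {a : ℝ | ∀ᶠ y in 𝓝 x, a ≤ v y}.Nonempty :=
  ⟨0, Eventually.of_forall hv⟩

theorem lowerEnv_nonneg (hv : ∀ x, 0 ≤ v x) (x : E) : 0 ≤ lowerEnv v x :=
  le_csSup (bddAbove_lowerEnv v x) (Eventually.of_forall hv)

theorem lowerEnv_le (hv : ∀ x, 0 ≤ v x) (x : E) : lowerEnv v x ≤ v x :=
  csSup_le (nonempty_lowerEnv hv x) fun a ha => (show ∀ᶠ y in 𝓝 x, a ≤ v y from ha).self_of_nhds

theorem lowerSemicontinuous_lowerEnv (hv : ∀ x, 0 ≤ v x) : LowerSemicontinuous (lowerEnv v) := by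
  intro x a hxa
  obtain ⟨b, hb, hab⟩ := exists_lt_of_lt_csSup (nonempty_lowerEnv hv x) hxa
  have hb : ∀ᶠ y in 𝓝 x, b ≤ v y := hb
  filter_upwards [hb.eventually_nhds] with y hy
  exact hab.trans_le (le_csSup (bddAbove_lowerEnv v y) hy)

theorem frequently_lt_of_lowerEnv_lt {x : E} {a : ℝ} (h : lowerEnv v x < a) :
    ∃ᶠ y in 𝓝 x, v y < a := by
  intro hcon
  refine absurd (le_csSup (bddAbove_lowerEnv v x) ?_) (not_le.2 h)
  exact hcon.mono fun y hy => not_lt.1 hy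

end LowerEnv

/-! ### Perron's method -/

/-- Nonnegative subsolutions of `F[u] ≤ lam u^α + 1` on `K`. -/
def perronFamily (F : Op N) (α lam : ℝ) (K : Set (Sp N)) : Set (Sp N → ℝ) :=
  {u | UpperSemicontinuousOn u K ∧ (∀ x ∈ K, 0 ≤ u x) ∧ IsPosSubsolution F α lam 1 K u}

/-- A largest element of the Perron family is a strict supersolution up to lower semicontinuous
regularization. -/
theorem one_le_of_isLocalMin_lowerEnv {F : Op N} {O : Set (Sp N)} {α lam : ℝ} (hα : 0 < α)
    (hO : IsOpen O) (hF : ContinuousOp F O) (h1 : H1 F O) {K : Set (Sp N)} (hKO : K ⊆ O)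
    {v : Sp N → ℝ} (hv0 : ∀ x, 0 ≤ v x) (hvusc : UpperSemicontinuous v)
    (hv : IsPosSubsolution F α lam 1 K v)
    (hvmax : ∀ w ∈ perronFamily F α lam K, ∀ x ∈ K, w x ≤ v x) {V : Set (Sp N)} (hV : IsOpen V)
    (hVK : V ⊆ K) {ψ : Sp N → ℝ} (hψ : ContDiff ℝ 2 ψ) {ξ : Sp N} (hξ : ξ ∈ V)
    (hmin : IsLocalMin (fun x => lowerEnv v x - ψ x) ξ) :
    lam * lowerEnv v ξ ^ α + 1 ≤ F ξ (lowerEnv v ξ) (gradient ψ ξ) (hessian ψ ξ) := by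
  by_contra! hlt
  set p := lowerEnv v with hp
  -- The constant lifts `ψ` to touch `p` at `ξ`; the quartic makes the contact strict.
  set q : Sp N → ℝ := fun x => (-1) * quartic ξ x + (p ξ - ψ ξ) with hq
  have hm : ContDiff ℝ 2 fun x => (-1) * quartic ξ x := contDiff_const.mul (contDiff_quartic ξ)
  have hq2 : ContDiff ℝ 2 q := hm.add contDiff_const
  have hqg : gradient q ξ = 0 := by
    rw [hq, gradient_add hm contDiff_const, gradient_const_mul (contDiff_quartic ξ),
      gradient_quartic_self, gradient_const_fun, smul_zero, add_zero]
  have hqh : hessian q ξ = 0 := by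
    rw [hq, hessian_add hm contDiff_const, hessian_const_mul (contDiff_quartic ξ),
      hessian_quartic_self, hessian_const_fun, smul_zero, add_zero]
  set χ : Sp N → ℝ := fun x => ψ x + q x with hχ
  have hχ2 : ContDiff ℝ 2 χ := hψ.add hq2
  have hχg : gradient χ ξ = gradient ψ ξ := by rw [hχ, gradient_add hψ hq2, hqg, add_zero]
  have hχh : hessian χ ξ = hessian ψ ξ := by rw [hχ, hessian_add hψ hq2, hqh, add_zero]
  have hχξ : χ ξ = p ξ := by simp [hχ, hq, quartic_self]
  have hχp : ∀ᶠ y in 𝓝 ξ, χ y + quartic ξ y ≤ p y := by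
    filter_upwards [hmin] with y hy
    simp only [hχ, hq]
    linarith
  have hcont : ∀ᶠ z in 𝓝 ξ ×ˢ 𝓝 (0 : ℝ),
      F z.1 (χ z.1 + z.2) (gradient χ z.1) (hessian χ z.1) < lam * (χ z.1 + z.2) ^ α + 1 := by
    rw [← nhds_prod_eq]
    have hmap : Continuous fun z : Sp N × ℝ => (z.1, χ z.1 + z.2) :=
      continuous_fst.prodMk ((hχ2.continuous.comp continuous_fst).add continuous_snd)
    have hmap0 : Tendsto (fun z : Sp N × ℝ => (z.1, χ z.1 + z.2)) (𝓝 (ξ, 0)) (𝓝 (ξ, p ξ)) := by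
      have := hmap.tendsto (ξ, 0)
      simpa [hχξ] using this
    have hOn : {q : Sp N × ℝ | q.1 ∈ O} ∈ 𝓝 (ξ, p ξ) :=
      (hO.preimage continuous_fst).mem_nhds (hKO (hVK hξ))
    have hl := ((continuousOn_op_test hF hχ2).continuousAt hOn).tendsto.comp hmap0
    have hr : Tendsto (fun z : Sp N × ℝ => lam * (χ z.1 + z.2) ^ α + 1) (𝓝 (ξ, 0))
        (𝓝 (lam * p ξ ^ α + 1)) := by
      have hpow : Tendsto (fun q : Sp N × ℝ => q.2 ^ α) (𝓝 (ξ, p ξ)) (𝓝 (p ξ ^ α)) :=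
        (Real.continuousAt_rpow_const (p ξ) α (Or.inr hα.le)).tendsto.comp
          continuous_snd.continuousAt
      exact ((hpow.comp hmap0).const_mul lam).add_const 1
    exact hl.eventually_lt hr (by simpa only [hχg, hχh] using hlt)
  obtain ⟨P, hP, Q, hQ, hPQ⟩ := eventually_prod_iff.1 hcont
  obtain ⟨δ₀, hδ₀, hQ⟩ := Metric.eventually_nhds_iff.1 hQ
  obtain ⟨r, hr, hball⟩ := Metric.eventually_nhds_iff.1 ((hP.and hχp).and (hV.mem_nhds hξ))
  -- The first bound keeps the raised function `χ + δ` a strict subsolution near `ξ`. The second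
  -- puts it below `p ≤ v` beyond radius `r / 2`, so gluing it to `v` creates no jump.
  obtain ⟨δ, hδ, hδ1, hδ2⟩ : ∃ δ, 0 < δ ∧ δ < δ₀ ∧ δ < ((r / 2) ^ 2) ^ 2 := by
    obtain ⟨δ, h0, h⟩ := exists_between (lt_min hδ₀ (show 0 < ((r / 2) ^ 2) ^ 2 by positivity))
    exact ⟨δ, h0, h.trans_le (min_le_left _ _), h.trans_le (min_le_right _ _)⟩
  have hQδ : Q δ := hQ (by rw [Real.dist_eq, sub_zero, abs_of_pos hδ]; exact hδ1)
  set w : Sp N → ℝ := fun y => if dist y ξ < r then max (v y) (χ y + δ) else v y with hw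
  have hw_in : ∀ y, dist y ξ < r → w y = max (v y) (χ y + δ) := fun y hy => if_pos hy
  have hw_ge : ∀ y, v y ≤ w y := fun y => by
    by_cases hy : dist y ξ < r
    · rw [hw_in y hy]; exact le_max_left _ _
    · exact (if_neg hy).ge
  have hw_far : ∀ y, r / 2 < dist y ξ → w y = v y := fun y hy => by
    by_cases hyr : dist y ξ < r
    · rw [hw_in y hyr]
      refine max_eq_left ?_
      have h2 := (hball hyr).1.2
      have h3 : ((r / 2) ^ 2) ^ 2 ≤ quartic ξ y := by
        rw [dist_eq_norm] at hy
        unfold quartic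
        gcongr
      have h4 := lowerEnv_le hv0 y
      linarith
    · exact if_neg hyr
  have hwusc : UpperSemicontinuous w := by
    intro x a hxa
    by_cases hx : dist x ξ < r
    · rw [hw_in x hx, max_lt_iff] at hxa
      have e1 : ∀ᶠ y in 𝓝 x, dist y ξ < r :=
        (isOpen_lt (continuous_id.dist continuous_const) continuous_const).mem_nhds hx
      have e2 : ∀ᶠ y in 𝓝 x, χ y + δ < a :=
        (isOpen_lt (hχ2.continuous.add continuous_const) continuous_const).mem_nhds hxa.2
      filter_upwards [e1, e2, hvusc x a hxa.1] with y h1 h2 h3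
      rw [hw_in y h1]
      exact max_lt h3 h2
    · have hx' : r / 2 < dist x ξ := by linarith [not_lt.1 hx]
      rw [hw_far x hx'] at hxa
      have e1 : ∀ᶠ y in 𝓝 x, r / 2 < dist y ξ :=
        (isOpen_lt continuous_const (continuous_id.dist continuous_const)).mem_nhds hx'
      filter_upwards [e1, hvusc x a hxa] with y h1 h3
      rwa [hw_far y h1]
  have hwsub : IsPosSubsolution F α lam 1 K w := by
    intro θ hθ x hxK hmaxx hpos
    by_cases hwx : w x = v x
    · rw [hwx] at hpos ⊢
      refine hv θ hθ x hxK (fun y hy => ?_) hpos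
      have h2 : w y - θ y ≤ w x - θ x := hmaxx hy
      have h3 := hw_ge y
      change v y - θ y ≤ v x - θ x
      linarith
    · have hx : dist x ξ < r := by
        by_contra h
        exact hwx (if_neg h)
      have hwx' : w x = χ x + δ := by
        rcases max_choice (v x) (χ x + δ) with h | h
        · exact absurd ((hw_in x hx).trans h) hwx
        · exact (hw_in x hx).trans h
      -- Where the bump is active, `w` equals `χ + δ` and lies above it nearby, so `θ` touches `χ +
      -- δ` from above. The ball lies in `K`, so the contact is an unconstrained one.
      have hloc : IsLocalMin (fun y => θ y - χ y) x := by
        have e1 : ∀ᶠ y in 𝓝 x, dist y ξ < r :=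
          (isOpen_lt (continuous_id.dist continuous_const) continuous_const).mem_nhds hx
        filter_upwards [e1] with y hy
        have h2 : w y - θ y ≤ w x - θ x := hmaxx (hVK (hball hy).2)
        have h3 : χ y + δ ≤ w y := by rw [hw_in y hy]; exact le_max_right _ _
        linarith
      have h2 := h1.le_of_isLocalMin hθ hχ2 (hKO hxK) hloc (w x)
      have h3 := hPQ (hball hx).1.1 hQδ
      simp only at h3
      rw [← hwx'] at h3
      exact h2.trans h3.le
  have hwfam : w ∈ perronFamily F α lam K :=
    ⟨hwusc.upperSemicontinuousOn K, fun x _ => (hv0 x).trans (hw_ge x), hwsub⟩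
  -- Near `ξ`, `v` takes values below `p ξ + δ / 2`, whereas the bump exceeds that level there; this
  -- contradicts maximality of `v`.
  have hfr : ∃ᶠ y in 𝓝 ξ, v y < p ξ + δ / 2 := frequently_lt_of_lowerEnv_lt (by linarith)
  have e1 : ∀ᶠ y in 𝓝 ξ, dist y ξ < r := Metric.eventually_nhds_iff.2 ⟨r, hr, fun _ h => h⟩
  have e2 : ∀ᶠ y in 𝓝 ξ, p ξ - δ / 2 < χ y :=
    (isOpen_lt continuous_const hχ2.continuous).mem_nhds
      (show p ξ - δ / 2 < χ ξ by rw [hχξ]; linarith)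
  obtain ⟨y, hy, hyr, hyχ⟩ := (hfr.and_eventually (e1.and e2)).exists
  have h2 := hvmax w hwfam y (hVK (hball hyr).2)
  have h3 : χ y + δ ≤ w y := by rw [hw_in y hyr]; exact le_max_right _ _
  linarith

/-- If the Perron family is bounded, there is a positive supersolution. -/
theorem exists_isSupersolution_of_bounded {F : Op N} {O : Set (Sp N)} {α lam : ℝ} (hα : 0 < α)
    (hO : IsOpen O) (hF : ContinuousOp F O) (h1 : H1 F O) (h2 : H2 F O α) {K : Set (Sp N)}
    (hK : IsCompact K) (hKO : K ⊆ O) {M : ℝ} (hM : 0 ≤ M)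
    (hbd : ∀ u ∈ perronFamily F α lam K, ∀ x ∈ K, u x ≤ M) {V : Set (Sp N)} (hV : IsOpen V)
    (hVK : V ⊆ K) :
    ∃ φ : Sp N → ℝ, LowerSemicontinuousOn φ V ∧ (∀ x ∈ V, 0 < φ x) ∧
      IsSupersolution F α lam V φ := by
  set u : perronFamily F α lam K → Sp N → ℝ := fun w => w with hu
  -- Eventually along `⊤` means for every member, so `v` is the upper semicontinuous envelope of the
  -- supremum over the family.
  set v := upperLim (⊤ : Filter (perronFamily F α lam K)) (fun _ => K) u with hvdef
  have huM : ∀ i : perronFamily F α lam K, ∀ x ∈ K, u i x ≤ M := fun i x hx => hbd i i.2 x hx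
  have hv0 : ∀ x, 0 ≤ v x := fun x => upperLim_nonneg x
  have hvusc : UpperSemicontinuous v := upperSemicontinuous_upperLim hM huM
  have hvsub : IsPosSubsolution F α lam 1 K v :=
    IsPosSubsolution.of_upperLim hα hO hF hK (fun _ => hK) (fun _ => Subset.rfl) hKO
      (fun x hx => tendsto_snd.eventually (hK.isClosed.isOpen_compl.mem_nhds hx))
      (fun i => i.2.1) hM huM (lam := fun _ => lam) (c := fun _ => 1) tendsto_const_nhds
      tendsto_const_nhds (fun i => i.2.2.2)
  have hvmax : ∀ w ∈ perronFamily F α lam K, ∀ x ∈ K, w x ≤ v x := by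
    intro w hw x hx
    by_contra! hlt
    have h := (eventually_lt_of_upperLim_lt hM huM hlt).curry
    have h' := (eventually_top.1 h ⟨w, hw⟩).self_of_nhds
    exact lt_irrefl _ (h' hx)
  have key : ∀ ψ : Sp N → ℝ, ContDiff ℝ 2 ψ → ∀ ξ ∈ V,
      IsLocalMin (fun x => lowerEnv v x - ψ x) ξ →
      lam * lowerEnv v ξ ^ α + 1 ≤ F ξ (lowerEnv v ξ) (gradient ψ ξ) (hessian ψ ξ) :=
    fun ψ hψ ξ hξ hmin =>
      one_le_of_isLocalMin_lowerEnv hα hO hF h1 hKO hv0 hvusc hvsub hvmax hV hVK hψ hξ hmin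
  refine ⟨lowerEnv v, (lowerSemicontinuous_lowerEnv hv0).lowerSemicontinuousOn V, ?_, ?_⟩
  · intro x hx
    -- At a zero the constant 0 touches from below, giving `1 ≤ F(x,0,0,0) = 0`.
    refine (lowerEnv_nonneg hv0 x).lt_of_ne fun h0 => ?_
    have h := key (fun _ => 0) contDiff_const x hx
      (Eventually.of_forall fun y => by simpa [← h0] using lowerEnv_nonneg hv0 y)
    rw [← h0, gradient_const_fun, hessian_const_fun, h2.apply_zero hα (hKO (hVK hx)),
      Real.zero_rpow hα.ne'] at h
    norm_num at h
  · intro ψ hψ ξ hξ hmin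
    have h := key ψ hψ ξ hξ (hmin.isLocalMin (hV.mem_nhds hξ))
    linarith

/-! ### From the eigenvalue to a nontrivial subsolution -/

/-- The constant `1` is a supersolution for very negative `l`, so the eigenvalue is not `-∞`. -/
theorem bot_lt_mu1 {F : Op N} {O Ω : Set (Sp N)} {α : ℝ} (hO : IsOpen O)
    (hF : ContinuousOp F O) (h1 : H1 F O) (hΩ : IsCompact (closure Ω)) (hΩO : closure Ω ⊆ O) :
    ⊥ < mu1 F α O Ω := by
  obtain ⟨K, hK, hΩK, hKO⟩ := exists_compact_between hΩ hO hΩO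
  have hcont : ContinuousOn (fun x : Sp N => F x 1 0 0) K := by
    have h : Continuous fun x : Sp N => (x, (1 : ℝ), (0 : Sp N), (0 : Mat N)) := by fun_prop
    exact hF.comp h.continuousOn fun x hx => ⟨hKO hx, Matrix.isSymm_zero⟩
  obtain ⟨l, hl⟩ := hK.bddBelow_image hcont
  refine (EReal.bot_lt_coe l).trans_le (le_sSup ⟨l, ?_, rfl⟩)
  refine ⟨interior K, isOpen_interior, hΩK, interior_subset.trans hKO, fun _ => 1,
    lowerSemicontinuous_const.lowerSemicontinuousOn _, fun _ _ => one_pos, ?_⟩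
  intro ψ hψ ξ hξ hmin
  have hξK := interior_subset hξ
  have hle := h1.le_of_isLocalMin contDiff_const hψ (hKO hξK)
    (hmin.isLocalMin (isOpen_interior.mem_nhds hξ)) 1
  rw [gradient_const_fun, hessian_const_fun] at hle
  have hlb : l ≤ F ξ 1 0 0 := hl ⟨ξ, hξK, rfl⟩
  rw [Real.one_rpow]
  linarith

/-- Above the eigenvalue the Perron family is unbounded. -/
theorem exists_lt_of_mu1_lt {F : Op N} {O Ω : Set (Sp N)} {α lam : ℝ} (hα : 0 < α)
    (hO : IsOpen O) (hF : ContinuousOp F O) (h1 : H1 F O) (h2 : H2 F O α) {K V : Set (Sp N)}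
    (hK : IsCompact K) (hKO : K ⊆ O) (hV : IsOpen V) (hΩV : closure Ω ⊆ V) (hVK : V ⊆ K)
    (hlam : mu1 F α O Ω < lam) (M : ℝ) :
    ∃ u ∈ perronFamily F α lam K, ∃ x ∈ K, M < u x := by
  by_contra! hcon
  refine not_le.2 hlam (le_sSup ⟨lam, ?_, rfl⟩)
  exact ⟨V, hV, hΩV, hVK.trans hKO, exists_isSupersolution_of_bounded hα hO hF h1 h2 hK hKO
    (le_max_right M 0) (fun u hu x hx => (hcon u hu x hx).trans (le_max_left _ _)) hV hVK⟩

theorem IsPosSubsolution.const_mul {F : Op N} {O : Set (Sp N)} {α lam : ℝ} (h2 : H2 F O α)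
    {K : Set (Sp N)} (hKO : K ⊆ O) {c : ℝ} {u : Sp N → ℝ} (hu : IsPosSubsolution F α lam c K u)
    {m : ℝ} (hm : 0 < m) : IsPosSubsolution F α lam (m ^ α * c) K fun x => m * u x := by
  intro φ hφ ξ hξ hmax hpos
  have hmi : 0 < m⁻¹ := inv_pos.2 hm
  have hpos' : 0 < u ξ := (mul_pos_iff_of_pos_left hm).1 hpos
  have h := hu (fun x => m⁻¹ * φ x) (contDiff_const.mul hφ) ξ hξ (fun y hy => ?_) hpos'
  · have hs : (m⁻¹ • hessian φ ξ).IsSymm := (isSymm_hessian hφ ξ).smul _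
    have hF := h2 ξ (hKO hξ) (u ξ) (m⁻¹ • gradient φ ξ) (m⁻¹ • hessian φ ξ) hs m hm.le
    rw [smul_inv_smul₀ hm.ne', smul_inv_smul₀ hm.ne'] at hF
    rw [gradient_const_mul hφ, hessian_const_mul hφ] at h
    rw [hF, Real.mul_rpow hm.le hpos'.le]
    have := mul_le_mul_of_nonneg_left h (Real.rpow_nonneg hm.le α)
    linarith
  · have h : m * u y - φ y ≤ m * u ξ - φ ξ := hmax hy
    have h' := mul_le_mul_of_nonneg_left h hmi.le
    rw [mul_sub, mul_sub, inv_mul_cancel_left₀ hm.ne', inv_mul_cancel_left₀ hm.ne'] at h'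
    exact h'

/-- Nonnegative functions with the differential inequality on their positivity set are
subsolutions of the Dirichlet problem in the relaxed sense. -/
theorem IsPosSubsolution.isDirichletSubsolution {F : Op N} {O Ω : Set (Sp N)} {α m : ℝ}
    (hα : 0 < α) (h1 : H1 F O) (h2 : H2 F O α) (hΩ : IsOpen Ω) (hΩO : closure Ω ⊆ O)
    {U : Sp N → ℝ} (hU0 : ∀ x, 0 ≤ U x) (hU : IsPosSubsolution F α m 0 (closure Ω) U) :
    IsDirichletSubsolution (eigenOp F α m) Ω U := by
  intro φ hφ ξ hξ hmax
  have hpos : 0 < U ξ → eigenOp F α m ξ (U ξ) (gradient φ ξ) (hessian φ ξ) ≤ 0 := fun h => by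
    have := hU φ hφ ξ hξ hmax h
    unfold eigenOp
    norm_cast
    linarith
  refine ⟨fun hξΩ => ?_, fun _ => ?_⟩
  · rcases (hU0 ξ).lt_or_eq with h | h
    · exact hpos h
    -- At an interior zero of `U` the test function has a local minimum, and ellipticity compares it
    -- with the constant 0.
    · have hloc : IsLocalMin (fun x => φ x - (0 : ℝ)) ξ := by
        filter_upwards [hΩ.mem_nhds hξΩ] with y hy
        have h3 : U y - φ y ≤ U ξ - φ ξ := hmax (subset_closure hy)
        have h4 := hU0 y
        linarith
      have hle := h1.le_of_isLocalMin hφ contDiff_const (hΩO hξ) hloc 0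
      rw [gradient_const_fun, hessian_const_fun, h2.apply_zero hα (hΩO hξ)] at hle
      unfold eigenOp
      rw [← h, Real.zero_rpow hα.ne']
      simpa using hle
  · rcases (hU0 ξ).lt_or_eq with h | h
    · exact (min_le_right _ _).trans (hpos h)
    · refine (min_le_left _ _).trans ?_
      rw [← h]
      simp

theorem eventually_notMem_cthickening {E : Type*} [PseudoEMetricSpace E] {C : Set E} {r : ℕ → ℝ}
    (hr : Tendsto r atTop (𝓝 0)) {x : E} (hx : x ∉ closure C) :
    ∀ᶠ p in atTop ×ˢ 𝓝 x, p.2 ∉ Metric.cthickening (r p.1) C := by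
  rw [Metric.closure_eq_iInter_cthickening] at hx
  simp only [mem_iInter, not_forall] at hx
  obtain ⟨ε, hε, hx⟩ := hx
  have e1 : ∀ᶠ p in (atTop : Filter ℕ) ×ˢ 𝓝 x, r p.1 < ε :=
    tendsto_fst.eventually (hr.eventually (gt_mem_nhds hε))
  have e2 : ∀ᶠ p in (atTop : Filter ℕ) ×ˢ 𝓝 x, p.2 ∉ Metric.cthickening ε C :=
    tendsto_snd.eventually (Metric.isClosed_cthickening.isOpen_compl.mem_nhds hx)
  filter_upwards [e1, e2] with p h1 h2 h3
  exact h2 (Metric.cthickening_mono h1.le C h3)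

/-- Existence of a nontrivial subsolution when the eigenvalue is finite. -/
theorem exists_isPosSubsolution_of_mu1_eq {F : Op N} {O Ω : Set (Sp N)} {α m : ℝ} (hα : 0 < α)
    (hO : IsOpen O) (hF : ContinuousOp F O) (h1 : H1 F O) (h2 : H2 F O α)
    (hΩ : IsCompact (closure Ω)) (hΩO : closure Ω ⊆ O) (hm : mu1 F α O Ω = m) :
    ∃ U : Sp N → ℝ, UpperSemicontinuous U ∧ (∀ x, 0 ≤ U x) ∧ (∃ x ∈ closure Ω, U x ≠ 0) ∧
      IsPosSubsolution F α m 0 (closure Ω) U := by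
  set C := closure Ω with hCdef
  obtain ⟨δ₁, hδ₁, hδO⟩ := hΩ.exists_cthickening_subset_open hO hΩO
  obtain ⟨δ₂, hδ₂, hδK⟩ := hΩ.exists_isCompact_cthickening
  set δ := min δ₁ δ₂
  have hδ : 0 < δ := lt_min hδ₁ hδ₂
  set r : ℕ → ℝ := fun n => δ * (1 / ((n : ℝ) + 1)) with hr
  have hr0 : ∀ n, 0 < r n := fun n => by positivity
  have hrδ : ∀ n, r n ≤ δ := fun n => by
    refine mul_le_of_le_one_right hδ.le ?_
    rw [div_le_one (by positivity)]
    linarith [n.cast_nonneg (α := ℝ)]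
  have hrt : Tendsto r atTop (𝓝 0) := by
    simpa [hr] using tendsto_one_div_add_atTop_nhds_zero_nat.const_mul δ
  set K : ℕ → Set (Sp N) := fun n => Metric.cthickening (r n) C with hKdef
  set K₀ := Metric.cthickening δ₂ C
  have hsub : ∀ n, K n ⊆ K₀ := fun n =>
    Metric.cthickening_mono ((hrδ n).trans (min_le_right _ _)) C
  have hK : ∀ n, IsCompact (K n) := fun n =>
    hδK.of_isClosed_subset Metric.isClosed_cthickening (hsub n)
  have hKO : ∀ n, K n ⊆ O := fun n =>
    (Metric.cthickening_mono ((hrδ n).trans (min_le_left _ _)) C).trans hδO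
  set lam : ℕ → ℝ := fun n => m + 1 / ((n : ℝ) + 1) with hlam
  have hlamt : Tendsto lam atTop (𝓝 m) := by
    simpa [hlam] using tendsto_one_div_add_atTop_nhds_zero_nat.const_add m
  -- Here `a` is the maximum of an unnormalized subsolution; dividing by it scales the source term 1
  -- to `a⁻¹ ^ α`.
  have hex : ∀ n : ℕ, ∃ (w : Sp N → ℝ) (a : ℝ), (n : ℝ) < a ∧ UpperSemicontinuousOn w (K n) ∧
      (∀ x ∈ K n, w x ≤ 1) ∧ (∃ x ∈ K n, w x = 1) ∧
      IsPosSubsolution F α (lam n) (a⁻¹ ^ α) (K n) w := by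
    intro n
    obtain ⟨u, ⟨huusc, -, husub⟩, x, hxK, hxn⟩ := exists_lt_of_mu1_lt hα hO hF h1 h2 (hK n) (hKO n)
      Metric.isOpen_thickening (Metric.self_subset_thickening (hr0 n) C)
      (Metric.thickening_subset_cthickening _ _) (lam := lam n)
      (by
        rw [hm, EReal.coe_lt_coe_iff]
        exact lt_add_of_pos_right m (by positivity)) n
    obtain ⟨z, hzK, hz⟩ := huusc.exists_isMaxOn ⟨x, hxK⟩ (hK n)
    have hzn : (n : ℝ) < u z := hxn.trans_le (hz hxK)
    have hz0 : 0 < u z := n.cast_nonneg.trans_lt hzn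
    refine ⟨fun y => (u z)⁻¹ * u y, u z, hzn, ?_, ?_, ⟨z, hzK, inv_mul_cancel₀ hz0.ne'⟩, ?_⟩
    · intro y hy a hya
      have hya' : u y < u z * a := by rwa [← inv_mul_lt_iff₀ hz0]
      exact (huusc y hy _ hya').mono fun t ht => (inv_mul_lt_iff₀ hz0).2 ht
    · intro y hy
      rw [inv_mul_le_iff₀ hz0, mul_one]
      exact hz hy
    · simpa using husub.const_mul h2 (hKO n) (inv_pos.2 hz0)
  choose w a han hwusc hw1 hwz hwsub using hex
  have hct : Tendsto (fun n => (a n)⁻¹ ^ α) atTop (𝓝 0) := by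
    have ha : Tendsto a atTop atTop :=
      tendsto_atTop_mono (fun n => (han n).le) tendsto_natCast_atTop_atTop
    have := (tendsto_inv_atTop_zero.comp ha).rpow_const (p := α) (Or.inr hα.le)
    simpa [Real.zero_rpow hα.ne'] using this
  have hout : ∀ x ∉ C, ∀ᶠ p in atTop ×ˢ 𝓝 x, p.2 ∉ K p.1 := fun x hx =>
    eventually_notMem_cthickening hrt (by rwa [hCdef, closure_closure])
  refine ⟨upperLim atTop K w, upperSemicontinuous_upperLim zero_le_one hw1, upperLim_nonneg, ?_,
    IsPosSubsolution.of_upperLim hα hO hF hδK hK hsub hΩO hout hwusc zero_le_one hw1 hlamt hct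
      hwsub⟩
  -- If the limit vanished on `C`, compactness would give `w n < 1` on all of `K n` for large `n`,
  -- but the value 1 is attained.
  by_contra! hzero
  have hev : ∀ᶠ n in atTop, ∀ y ∈ K₀, y ∈ K n → w n y < 1 := by
    refine eventually_forall_of_isCompact hδK fun x _ => ?_
    by_cases hx : x ∈ C
    · exact eventually_lt_of_upperLim_lt zero_le_one hw1 (by rw [hzero x hx]; exact one_pos)
    · exact (hout x hx).mono fun p hp hpK => absurd hpK hp
  obtain ⟨n, hn⟩ := hev.exists
  obtain ⟨z, hzK, hz⟩ := hwz n
  exact (hn z (hsub n hzK) hzK).ne hz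

/-- Existence of a nontrivial nonnegative subsolution for the eigenvalue. -/
theorem exists_isDirichletSubsolution_mu1 {F : Op N} {O Ω : Set (Sp N)} {α : ℝ} (hα : 0 < α)
    (hO : IsOpen O) (hF : ContinuousOp F O) (h1 : H1 F O) (h2 : H2 F O α) (hΩ : IsOpen Ω)
    (hne : Ω.Nonempty) (hΩc : IsCompact (closure Ω)) (hΩO : closure Ω ⊆ O) :
    ∃ U : Sp N → ℝ, UpperSemicontinuousOn U (closure Ω) ∧ (∀ x ∈ closure Ω, 0 ≤ U x) ∧
      (∃ x ∈ closure Ω, U x ≠ 0) ∧ IsDirichletSubsolution (eigenOp F α (mu1 F α O Ω)) Ω U := by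
  have hbot := bot_lt_mu1 (α := α) hO hF h1 hΩc hΩO
  generalize hμ : mu1 F α O Ω = μ at hbot ⊢
  induction μ with
  | bot => exact absurd hbot (lt_irrefl _)
  | coe m =>
    obtain ⟨U, hU, hU0, hUne, hUsub⟩ :=
      exists_isPosSubsolution_of_mu1_eq hα hO hF h1 h2 hΩc hΩO hμ
    exact ⟨U, hU.upperSemicontinuousOn _, fun x _ => hU0 x, hUne,
      hUsub.isDirichletSubsolution hα h1 h2 hΩ hΩO hU0⟩
  | top =>
    -- For the constant 1 the operator is `F - ∞ = -∞`, even at boundary points.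
    obtain ⟨x, hx⟩ := hne
    refine ⟨fun _ => 1, upperSemicontinuous_const.upperSemicontinuousOn _,
      fun _ _ => zero_le_one, ⟨x, subset_closure hx, one_ne_zero⟩, ?_⟩
    intro φ _ ξ _ _
    have h : eigenOp F α ⊤ ξ 1 (gradient φ ξ) (hessian φ ξ) ≤ 0 := by
      simp [eigenOp, EReal.sub_top]
    exact ⟨fun _ => h, fun _ => (min_le_right _ _).trans h⟩

/-- With `μ ≤ 0` and `r ≥ 0`, the term `-μ r^α` is nonnegative, so dropping it preserves the
inequality. -/
theorem le_zero_of_eigenOp_le_zero {F : Op N} {α : ℝ} {μ : EReal} (hμ : μ ≤ 0) {x : Sp N} {r : ℝ}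
    (hr : 0 ≤ r) {p : Sp N} {X : Mat N} (h : eigenOp F α μ x r p X ≤ 0) :
    (F x r p X : EReal) ≤ 0 := by
  have hmul : μ * ((r ^ α : ℝ) : EReal) ≤ 0 :=
    mul_nonpos_of_nonpos_of_nonneg hμ (by exact_mod_cast Real.rpow_nonneg hr α)
  refine le_trans ?_ h
  have := EReal.sub_le_sub (le_refl (F x r p X : EReal)) hmul
  simpa [eigenOp] using this

end DegEll

end

/-! ### The main theorem -/

theorem proposition3p2 (N : ℕ) (O Ω : Set (DegEll.Sp N)) (hO : IsOpen O)
    (hΩ : IsOpen Ω) (hΩc : IsConnected Ω) (hΩb : Bornology.IsBounded Ω) (hΩO : closure Ω ⊆ O)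
    (F : DegEll.Op N) (α : ℝ) (hα : 0 < α) (hF : DegEll.ContinuousOp F O)
    (h1 : DegEll.H1 F O) (h2 : DegEll.H2 F O α) (h3 : DegEll.H3 F O) (h4 : DegEll.H4 F O) :
    (∃ U : DegEll.Sp N → ℝ, UpperSemicontinuousOn U (closure Ω) ∧
      (∀ x ∈ closure Ω, 0 ≤ U x) ∧ (∃ x ∈ closure Ω, U x ≠ 0) ∧
      DegEll.IsDirichletSubsolution (DegEll.eigenOp F α (DegEll.mu1 F α O Ω)) Ω U) ∧
    (DegEll.MaximumPrinciple F Ω → 0 < DegEll.mu1 F α O Ω) := by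
  obtain ⟨U, hU, hU0, hUne, hUsub⟩ :=
    DegEll.exists_isDirichletSubsolution_mu1 hα hO hF h1 h2 hΩ hΩc.nonempty hΩb.isCompact_closure
      hΩO
  refine ⟨⟨U, hU, hU0, hUne, hUsub⟩, fun hMP => ?_⟩
  by_contra! hμ
  obtain ⟨x, hx, hxne⟩ := hUne
  refine hxne (le_antisymm (hMP U hU (fun φ hφ ξ hξ hmax => ?_) x hx) (hU0 x hx))
  obtain ⟨hi, hb⟩ := hUsub φ hφ ξ hξ hmax
  refine ⟨fun h => DegEll.le_zero_of_eigenOp_le_zero hμ (hU0 ξ hξ) (hi h), fun h => ?_⟩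
  rcases min_le_iff.1 (hb h) with h' | h'
  · exact (min_le_left _ _).trans h'
  · exact (min_le_right _ _).trans (DegEll.le_zero_of_eigenOp_le_zero hμ (hU0 ξ hξ) h')
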